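/- Let $M>0$ and $E\in(\sqrt{25/27},1)$. For $H<0$, $L>0$, $r>2M$ put $\alpha(r)=1-\frac{2M}{r}$ and $$Z(r;H,L)=\Bigl(\frac{L^2}{2r^2}-\frac{E^2}{2\alpha(r)}-H\Bigr)\alpha(r)=\Bigl(\frac{L^2}{2r^2}-H\Bigr)\alpha(r)-\frac{E^2}{2},$$ the effective potential of the equatorial geodesics of energy $E$ and angular momentum $L$ of the Schwarzschild metric of mass $M$. Let $$r^*(H,L)=\frac{L^2-L\sqrt{L^2+24HM^2}}{-4HM},\qquad r_0(H,L)=\frac{L^2+L\sqrt{L^2+24HM^2}}{-4HM}$$ be the maximum and the minimum point of $Z(\cdot;H,L)$ when $L>4\sqrt2\sqrt{-H}\,M$. For such $(H,L)$ with moreover $E^2<-2H$ and $Z(r_0(H,L);H,L)<0$ (for $H=-\frac12$ this means $4M<L<L_E$, with $L_E$ as below), let $r_-(H,L)\in(r^*,r_0)$ and $r_+(H,L)\in(r_0,+\infty)$ be the zeros of $Z(\cdot;H,L)$ in these intervals, and let $$\Theta(H,L)=\sqrt2\,L\int_{1/r_+(H,L)}^{1/r_-(H,L)}\frac{\mathrm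 ds}{\sqrt{-Z(1/s;H,L)}}$$ be the apsidal angle. Let moreover $$\zeta(u)=\frac{u^4-20u^2+32+u(u^2-8)\sqrt{u^2-24}}{u^4-18u^2+u(u^2-6)\sqrt{u^2-24}},\qquad u\in(4\sqrt2,+\infty),$$ which is an increasing bijection of $(4\sqrt2,+\infty)$ onto $(25/27,1)$, and $L_E=\frac{M}{\sqrt2}\,\zeta^{-1}(E^2)$. Then $4M<L_E$; for every $L\in(4M,L_E)$ the integral defining $\Theta(-\frac12,L)$ converges and $\Theta(-\frac12,\cdot)$ is differentiable at $L$; and $$\lim_{L\to (L_E)^-}\partial_L\Theta\Bigl(-\frac12,L\Bigr)=\frac{-3\pi\left(4\sqrt{\frac{L_E^2}{M^2}-12}+\frac{5}{\sqrt2}\,\frac{L_E^2}{M^2}\,\zeta'\Bigl(\sqrt2\,\frac{L_E}{M}\Bigr)\right)}{M\sqrt{\frac{L_E}{M}}\,\left(\frac{L_E^2}{M^2}-12\right)^{7/4}}.$$ This limit is strictly negative; in particular it is non-zero. -/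

import Mathlib

open Set Filter Topology

noncomputable section

namespace Schwarzschild

/-- The effective potential `Z(r; H, L) = (L² / (2 r²) - V(r) - H) α(r)` of the planar Hamiltonian
`(α(r) p_r² + p_ϑ² / r²) / 2 - V(r)` at energy `H` and angular momentum `L`. -/
def effectivePotential (α V : ℝ → ℝ) (H L r : ℝ) : ℝ :=
  ((1 / 2) * (L ^ 2 / r ^ 2) - V r - H) * α r

/-- The Schwarzschild coefficient `α(r) = 1 - 2M / r`, used for `r > 2M`. -/
def alpha (M r : ℝ) : ℝ := 1 - 2 * M / r

/-- The potential `V(r) = E² / (2 α(r))` of the equatorial reduced Hamiltonian. -/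
def pot (M E r : ℝ) : ℝ := (1 / 2) * (E ^ 2 / alpha M r)

/-- The effective potential of equatorial Schwarzschild geodesics with particle energy `E`. -/
def Z (M E H L r : ℝ) : ℝ := effectivePotential (alpha M) (pot M E) H L r

/-- The maximum point `r^*(H, L)` of `Z(·; H, L)` on `(2M, ∞)`. -/
def rStar (M H L : ℝ) : ℝ :=
  (L ^ 2 - L * √(L ^ 2 + 24 * H * M ^ 2)) / (-4 * H * M)

/-- The minimum point `r_0(H, L)` of `Z(·; H, L)` on `(2M, ∞)`. -/
def r0 (M H L : ℝ) : ℝ :=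
  (L ^ 2 + L * √(L ^ 2 + 24 * H * M ^ 2)) / (-4 * H * M)

/-- The inner turning point `r_-(H, L)`: the zero of `Z(·; H, L)` in `(r^*, r_0)`. For the pairs
`(H, L)` under consideration `Z(·; H, L)` is strictly decreasing there, with exactly one zero, so
that the supremum is taken over a one-point set. -/
def rMinus (M E H L : ℝ) : ℝ :=
  sSup {r : ℝ | rStar M H L < r ∧ r < r0 M H L ∧ Z M E H L r = 0}

/-- The outer turning point `r_+(H, L)`: the zero of `Z(·; H, L)` in `(r_0, ∞)`. For the pairs
`(H, L)` under consideration `Z(·; H, L)` is strictly increasing there, with exactly one zero, so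
that the infimum is taken over a one-point set. -/
def rPlus (M E H L : ℝ) : ℝ :=
  sInf {r : ℝ | r0 M H L < r ∧ Z M E H L r = 0}

/-- The integrand of the apsidal angle, in the variable `s = 1 / r`. -/
def apsidalIntegrand (M E H L s : ℝ) : ℝ := 1 / √(-Z M E H L (1 / s))

/-- The apsidal angle `Θ(H, L) = √2 L ∫_{1/r_+}^{1/r_-} ds / √(-Z(1/s; H, L))`. -/
def apsidalAngle (M E H L : ℝ) : ℝ :=
  √2 * L * ∫ s in (1 / rPlus M E H L)..(1 / rMinus M E H L), apsidalIntegrand M E H L s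

/-- The auxiliary function `ζ`, considered on `(4√2, ∞)`. -/
def zeta (u : ℝ) : ℝ :=
  (u ^ 4 - 20 * u ^ 2 + 32 + u * (u ^ 2 - 8) * √(u ^ 2 - 24)) /
    (u ^ 4 - 18 * u ^ 2 + u * (u ^ 2 - 6) * √(u ^ 2 - 24))

/-- The inverse of `ζ : (4√2, ∞) → ℝ`. -/
def zetaInv : ℝ → ℝ := Function.invFunOn zeta (Ioi (4 * √2))

/-- The limiting angular momentum `L_E = (M / √2) ζ⁻¹(E²)`. -/
def LE (M E : ℝ) : ℝ := M / √2 * zetaInv (E ^ 2)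

end Schwarzschild

end

/-!
In the variable `x = M / r`, with `e = E²`, `l = L / M` and `H = -1/2`, the function `-2 Z` is the
cubic `e - (1 + l² x²) (1 - 2 x)`. Its roots sum to `1/2`, so a bounded orbit with turning points
`x = m ± d` has third root `1/2 - 2 m`, and the remaining Vieta relations express both `1 / l²`
(`invSqMom`) and `d²` (`sqAmp`) as explicit rational functions of the midpoint `m`.

The substitution `x = m + d sin φ` removes the endpoint singularities and turns the apsidal angle
into `2 ∫ dφ / √(1 - 6 m - 2 d sin φ)` over `[-π/2, π/2]`. Averaging the integrand over `±φ` gives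
a function of `d²`, which is smooth across `d = 0` (`kernel`). Hence the apsidal angle is
`midpointAngle e m` (`apsidalAngle_eq_midpointAngle`), a continuously differentiable function of
`m` on an open set that contains the circular orbit `m₀`, where `d² = 0`.

Since `l` is a strictly decreasing function of `m` with non-vanishing derivative (`angMom`), the
inverse function theorem gives `∂_L Θ = (dΘ/dm) / (dl/dm) / M` for every orbit
(`hasDerivAt_apsidalAngle`). The right-hand side is continuous up to `m₀`, and `d² > 0` exactly for
`m > m₀`, that is for `L < L_E`; this yields the limit (`tendsto_deriv_apsidalAngle`). At `m₀` the
integrand is elementary (`midpointAngleDeriv_of_sqAmp_eq_zero`).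

The circular orbit at `m` has `l² = 1 / (m (1 - 3 m))` and `e = (1 - 2 m)² / (1 - 3 m)`, and `ζ` is
the relation between the two (`zeta_circMom`). This identifies `L_E` and gives `ζ'`, which is
positive, in terms of `m₀`.
-/

namespace Schwarzschild

/-! ### Integrals depending on a parameter -/

/-- Differentiation under the integral sign over a compact interval, together with continuity of
the resulting derivative, when the partial derivative is jointly continuous. -/
theorem hasDerivAt_intervalIntegral_of_continuousOn {f f' : ℝ → ℝ → ℝ} {U : Set ℝ} {a b : ℝ}
    (hU : IsOpen U) (hf : ∀ x ∈ U, ∀ t, HasDerivAt (fun y => f y t) (f' x t) x)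
    (hfc : ∀ x ∈ U, Continuous (f x))
    (hf' : ContinuousOn (fun p : ℝ × ℝ => f' p.1 p.2) (U ×ˢ univ)) {x : ℝ} (hx : x ∈ U) :
    HasDerivAt (fun y => ∫ t in a..b, f y t) (∫ t in a..b, f' x t) x ∧
      ContinuousAt (fun y => ∫ t in a..b, f' y t) x := by
  obtain ⟨K, hK, hxK, hKU⟩ := exists_compact_subset hU hx
  have hKn : K ∈ 𝓝 x := mem_interior_iff_mem_nhds.1 hxK
  have hcomp : IsCompact (K ×ˢ uIcc a b) := hK.prod isCompact_uIcc
  obtain ⟨C, hC⟩ := hcomp.exists_bound_of_continuousOn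
    (hf'.mono (prod_mono hKU (subset_univ _)))
  have hf'c : ∀ y ∈ U, Continuous (f' y) := fun y hy => by
    rw [← continuousOn_univ]
    exact hf'.comp (f := fun t : ℝ => (y, t)) (by fun_prop) fun t _ => ⟨hy, mem_univ t⟩
  have hbound : ∀ t, t ∈ uIoc a b → ∀ y ∈ K, ‖f' y t‖ ≤ C := fun t ht y hy =>
    hC (y, t) ⟨hy, uIoc_subset_uIcc ht⟩
  refine ⟨(intervalIntegral.hasDerivAt_integral_of_dominated_loc_of_deriv_le (bound := fun _ => C)
    hKn ?_ ((hfc x hx).intervalIntegrable _ _) (hf'c x hx).aestronglyMeasurable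
    (.of_forall hbound) intervalIntegrable_const
    (.of_forall fun t _ y hy => hf y (hKU hy) t)).2, ?_⟩
  · filter_upwards [hU.mem_nhds hx] with y hy using (hfc y hy).aestronglyMeasurable
  · refine intervalIntegral.continuousAt_of_dominated_interval (bound := fun _ => C) ?_ ?_
      intervalIntegrable_const (.of_forall fun t _ => ?_)
    · filter_upwards [hU.mem_nhds hx] with y hy using (hf'c y hy).aestronglyMeasurable
    · filter_upwards [hKn] with y hy using .of_forall fun t ht => hbound t ht y hy
    · have h : ContinuousOn (fun y => f' y t) U :=
        hf'.comp (f := fun y : ℝ => (y, t)) (by fun_prop) fun y hy => ⟨hy, mem_univ t⟩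
      exact h.continuousAt (hU.mem_nhds hx)

/-! ### Bounded orbits parametrised by the midpoint of their turning points -/

/-- `M² / L²` as a function of the midpoint `m` of the two turning points, measured in the variable
`x = M / r`, for an orbit with `E² = e`. -/
noncomputable def invSqMom (e m : ℝ) : ℝ := m * (1 - 4 * m) ^ 2 / (e - 4 * m)

/-- The derivative of `invSqMom e` at `m`. -/
noncomputable def invSqMomDeriv (e m : ℝ) : ℝ :=
  (((1 - 4 * m) ^ 2 - 8 * m * (1 - 4 * m)) * (e - 4 * m) + 4 * (m * (1 - 4 * m) ^ 2)) /
    (e - 4 * m) ^ 2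

/-- The square `d²` of the half-distance between the turning points `m - d` and `m + d`. It is
negative when the midpoint `m` is not realised by any orbit. -/
noncomputable def sqAmp (e m : ℝ) : ℝ := m - 3 * m ^ 2 - invSqMom e m

/-- The normalised angular momentum `L / M` as a function of the midpoint `m`. -/
noncomputable def angMom (e m : ℝ) : ℝ := 1 / √(invSqMom e m)

/-- The derivative of `angMom e` at `m`. -/
noncomputable def angMomDeriv (e m : ℝ) : ℝ :=
  -(invSqMomDeriv e m / (2 * √(invSqMom e m))) / √(invSqMom e m) ^ 2

/-- The midpoints at which the symmetrised integrand of the apsidal angle is smooth. The set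
contains the circular orbit `sqAmp e m = 0` in its interior. -/
def regularMidpoints (e : ℝ) : Set ℝ :=
  {m | 0 < m ∧ m < 1 / 8 ∧ 4 * sqAmp e m < (1 - 6 * m) ^ 2}

/-- The midpoints of the turning points of bounded non-circular orbits: the turning points
`m ± d` and the third root `1 / 2 - 2 * m` satisfy `0 < m - d < m + d < 1 / 2 - 2 * m`. -/
def orbitMidpoints (e : ℝ) : Set ℝ :=
  {m | m ∈ regularMidpoints e ∧ 0 < sqAmp e m ∧ sqAmp e m < m ^ 2}

theorem hasStrictDerivAt_invSqMom {e m : ℝ} (h : e - 4 * m ≠ 0) :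
    HasStrictDerivAt (invSqMom e) (invSqMomDeriv e m) m := by
  have h1 : HasStrictDerivAt (fun m : ℝ => m) 1 m := hasStrictDerivAt_id m
  have h2 := ((h1.const_mul 4).const_sub 1).pow 2
  have h3 := (h1.mul h2).div ((h1.const_mul 4).const_sub e) h
  refine h3.congr_deriv ?_
  simp only [invSqMomDeriv, Pi.mul_apply, Pi.pow_apply]
  congr 1
  ring

theorem invSqMom_pos {e m : ℝ} (he : 1 / 2 < e) (h0 : 0 < m) (h1 : m < 1 / 8) :
    0 < invSqMom e m :=
  div_pos (mul_pos h0 (pow_pos (by linarith) 2)) (by linarith)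

theorem invSqMomDeriv_pos {e m : ℝ} (he : 1 / 2 < e) (he1 : e < 1) (h0 : 0 < m) (h1 : m < 1 / 8) :
    0 < invSqMomDeriv e m := by
  have h : 0 < e - 4 * m := by linarith
  refine div_pos ?_ (pow_pos h 2)
  have : ((1 - 4 * m) ^ 2 - 8 * m * (1 - 4 * m)) * (e - 4 * m) + 4 * (m * (1 - 4 * m) ^ 2) =
    (1 - 4 * m) * ((1 - 8 * m) * (e - 4 * m) + 4 * m * (1 - e)) := by ring
  rw [this]
  have h2 := mul_pos (by linarith : 0 < 1 - 8 * m) h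
  have h3 := mul_pos h0 (by linarith : 0 < 1 - e)
  exact mul_pos (by linarith) (by linarith)

theorem hasStrictDerivAt_angMom {e m : ℝ} (he : 1 / 2 < e) (h0 : 0 < m) (h1 : m < 1 / 8) :
    HasStrictDerivAt (angMom e) (angMomDeriv e m) m := by
  have hp := invSqMom_pos he h0 h1
  have h := (hasStrictDerivAt_const m (1 : ℝ)).div
    ((hasStrictDerivAt_invSqMom (e := e) (m := m) (by linarith)).sqrt hp.ne')
    (Real.sqrt_pos.2 hp).ne'
  refine h.congr_deriv ?_
  rw [angMomDeriv]
  ring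

theorem angMomDeriv_neg {e m : ℝ} (he : 1 / 2 < e) (he1 : e < 1) (h0 : 0 < m) (h1 : m < 1 / 8) :
    angMomDeriv e m < 0 := by
  have hp := Real.sqrt_pos.2 (invSqMom_pos he h0 h1)
  have := invSqMomDeriv_pos he he1 h0 h1
  exact div_neg_of_neg_of_pos (neg_neg_of_pos (by positivity)) (by positivity)

theorem strictAntiOn_angMom {e : ℝ} (he : 1 / 2 < e) (he1 : e < 1) :
    StrictAntiOn (angMom e) (Ioo 0 (1 / 8)) := by
  refine strictAntiOn_of_deriv_neg (convex_Ioo _ _) (fun m hm =>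
    (hasStrictDerivAt_angMom he hm.1 hm.2).hasDerivAt.continuousAt.continuousWithinAt)
    fun m hm => ?_
  rw [interior_Ioo] at hm
  rw [(hasStrictDerivAt_angMom he hm.1 hm.2).hasDerivAt.deriv]
  exact angMomDeriv_neg he he1 hm.1 hm.2

theorem hasDerivAt_sqAmp {e m : ℝ} (h : e - 4 * m ≠ 0) :
    HasDerivAt (sqAmp e) (1 - 6 * m - invSqMomDeriv e m) m := by
  have h1 := ((hasDerivAt_id m).sub (((hasDerivAt_id m).pow 2).const_mul 3)).sub
    (hasStrictDerivAt_invSqMom h).hasDerivAt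
  refine (h1.congr_deriv ?_).congr_of_eventuallyEq (.of_forall fun y => ?_)
  · simp only [id]; ring
  · simp [sqAmp]

theorem continuousAt_sqAmp {e m : ℝ} (he : 1 / 2 < e) (h1 : m < 1 / 8) :
    ContinuousAt (sqAmp e) m :=
  (hasDerivAt_sqAmp (by linarith)).continuousAt

theorem isOpen_regularMidpoints {e : ℝ} (he : 1 / 2 < e) : IsOpen (regularMidpoints e) := by
  refine isOpen_iff_mem_nhds.2 fun m ⟨h0, h1, h2⟩ => ?_
  filter_upwards [lt_mem_nhds h0, gt_mem_nhds h1,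
    ((continuousAt_sqAmp he h1).const_mul 4).eventually_lt
      (g := fun m => (1 - 6 * m) ^ 2) (by fun_prop) h2] with y a b c using ⟨a, b, c⟩

theorem isOpen_orbitMidpoints {e : ℝ} (he : 1 / 2 < e) : IsOpen (orbitMidpoints e) := by
  refine isOpen_iff_mem_nhds.2 fun m ⟨h, h1, h2⟩ => ?_
  have hc := continuousAt_sqAmp he h.2.1
  filter_upwards [(isOpen_regularMidpoints he).mem_nhds h, hc.eventually (lt_mem_nhds h1),
    hc.eventually_lt (g := fun m => m ^ 2) (by fun_prop) h2] with y a b c using ⟨a, b, c⟩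

/-! ### The symmetrised integrand -/

/-- The product of the two values `1 - 6 * m ∓ 2 * d * sin φ`, in terms of `d² = sqAmp e m`. -/
noncomputable def radicand (e m φ : ℝ) : ℝ := (1 - 6 * m) ^ 2 - 4 * sqAmp e m * Real.sin φ ^ 2

/-- The mean of `1 / √(1 - 6 * m - 2 * d * sin φ)` and `1 / √(1 - 6 * m + 2 * d * sin φ)`, written
as a function of `d²`, so that it is smooth across `d = 0`. -/
noncomputable def kernel (e m φ : ℝ) : ℝ :=
  √(2 * (1 - 6 * m + √(radicand e m φ))) / (2 * √(radicand e m φ))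

/-- The derivative in `m` of `√(radicand e m φ)`. -/
noncomputable def sqrtRadicandDeriv (e m φ : ℝ) : ℝ :=
  (-12 * (1 - 6 * m) - 4 * (1 - 6 * m - invSqMomDeriv e m) * Real.sin φ ^ 2) /
    (2 * √(radicand e m φ))

/-- The derivative in `m` of `kernel e m φ`. -/
noncomputable def kernelDeriv (e m φ : ℝ) : ℝ :=
  (2 * (-6 + sqrtRadicandDeriv e m φ) / (2 * √(2 * (1 - 6 * m + √(radicand e m φ)))) *
      (2 * √(radicand e m φ)) -
    √(2 * (1 - 6 * m + √(radicand e m φ))) * (2 * sqrtRadicandDeriv e m φ)) /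
    (2 * √(radicand e m φ)) ^ 2

/-- The apsidal angle as a function of the midpoint of the turning points. -/
noncomputable def midpointAngle (e m : ℝ) : ℝ :=
  2 * ∫ φ in -(Real.pi / 2)..Real.pi / 2, kernel e m φ

/-- The derivative of `midpointAngle e` at `m`. -/
noncomputable def midpointAngleDeriv (e m : ℝ) : ℝ :=
  2 * ∫ φ in -(Real.pi / 2)..Real.pi / 2, kernelDeriv e m φ

theorem radicand_pos {e m : ℝ} (h : m ∈ regularMidpoints e) (φ : ℝ) : 0 < radicand e m φ := by
  obtain ⟨h0, h1, h2⟩ := h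
  have hs := Real.sin_sq_le_one φ
  have hs0 := sq_nonneg (Real.sin φ)
  unfold radicand
  rcases le_total (sqAmp e m) 0 with hD | hD
  · nlinarith [mul_nonneg (neg_nonneg.2 hD) hs0, pow_pos (by linarith : 0 < 1 - 6 * m) 2]
  · nlinarith [mul_nonneg hD (sub_nonneg.2 hs)]

theorem hasDerivAt_kernel {e m : ℝ} (he : 1 / 2 < e) (h : m ∈ regularMidpoints e) (φ : ℝ) :
    HasDerivAt (fun y => kernel e y φ) (kernelDeriv e m φ) m := by
  have hR := radicand_pos h φ
  have hq := Real.sqrt_pos.2 hR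
  have ha : HasDerivAt (fun y : ℝ => 1 - 6 * y) (-6) m := by
    simpa using ((hasDerivAt_id m).const_mul 6).const_sub 1
  have hd : HasDerivAt (fun y => radicand e y φ)
      (-12 * (1 - 6 * m) - 4 * (1 - 6 * m - invSqMomDeriv e m) * Real.sin φ ^ 2) m := by
    have hD := hasDerivAt_sqAmp (e := e) (m := m) (by linarith [h.2.1])
    refine ((ha.pow 2).sub ((hD.const_mul 4).mul_const (Real.sin φ ^ 2))).congr_deriv ?_
    ring
  have hQ : HasDerivAt (fun y => √(radicand e y φ)) (sqrtRadicandDeriv e m φ) m := hd.sqrt hR.ne'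
  have hpos : 0 < 2 * (1 - 6 * m + √(radicand e m φ)) := by linarith [h.2.1]
  exact (((ha.add hQ).const_mul 2).sqrt hpos.ne').div (hQ.const_mul 2) (by positivity)

theorem continuousOn_radicand {e : ℝ} (he : 1 / 2 < e) :
    ContinuousOn (fun p : ℝ × ℝ => radicand e p.1 p.2) (regularMidpoints e ×ˢ univ) := by
  have h : ContinuousOn (fun p : ℝ × ℝ => sqAmp e p.1) (regularMidpoints e ×ˢ univ) :=
    ContinuousOn.comp (t := regularMidpoints e)
      (fun m hm => (continuousAt_sqAmp he hm.2.1).continuousWithinAt) (by fun_prop)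
      fun p hp => hp.1
  unfold radicand
  fun_prop

theorem continuousOn_kernelDeriv {e : ℝ} (he : 1 / 2 < e) :
    ContinuousOn (fun p : ℝ × ℝ => kernelDeriv e p.1 p.2) (regularMidpoints e ×ˢ univ) := by
  have hR := (continuousOn_radicand he).sqrt
  have hR0 : ∀ p ∈ regularMidpoints e ×ˢ (univ : Set ℝ), √(radicand e p.1 p.2) ≠ 0 :=
    fun p hp => (Real.sqrt_pos.2 (radicand_pos hp.1 p.2)).ne'
  have hW : ContinuousOn (fun p : ℝ × ℝ => invSqMomDeriv e p.1) (regularMidpoints e ×ˢ univ) := by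
    unfold invSqMomDeriv
    exact ContinuousOn.div (by fun_prop) (by fun_prop)
      fun p hp => pow_ne_zero 2 (by linarith [hp.1.2.1])
  have hS : ContinuousOn (fun p : ℝ × ℝ => sqrtRadicandDeriv e p.1 p.2)
      (regularMidpoints e ×ˢ univ) := by
    unfold sqrtRadicandDeriv
    exact ContinuousOn.div (by fun_prop) (by fun_prop) fun p hp => by simpa using hR0 p hp
  unfold kernelDeriv
  refine ContinuousOn.div (ContinuousOn.sub (ContinuousOn.mul (ContinuousOn.div (by fun_prop)
    (by fun_prop) fun p hp => ?_) (by fun_prop)) (by fun_prop)) (by fun_prop)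
    fun p hp => by simpa using hR0 p hp
  have := Real.sqrt_nonneg (radicand e p.1 p.2)
  have hpos : 0 < 2 * (1 - 6 * p.1 + √(radicand e p.1 p.2)) := by linarith [hp.1.2.1]
  have := Real.sqrt_pos.2 hpos
  positivity

theorem continuous_kernel {e m : ℝ} (h : m ∈ regularMidpoints e) : Continuous (kernel e m) := by
  have hR : Continuous (radicand e m) := by unfold radicand; fun_prop
  exact Continuous.div (by fun_prop) (by fun_prop)
    fun φ => by have := Real.sqrt_pos.2 (radicand_pos h φ); positivity

theorem hasDerivAt_midpointAngle {e m : ℝ} (he : 1 / 2 < e) (h : m ∈ regularMidpoints e) :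
    HasDerivAt (midpointAngle e) (midpointAngleDeriv e m) m :=
  (hasDerivAt_intervalIntegral_of_continuousOn (isOpen_regularMidpoints he)
    (fun _ hx => hasDerivAt_kernel he hx) (fun _ hx => continuous_kernel hx)
    (continuousOn_kernelDeriv he) h).1.const_mul 2

theorem continuousAt_midpointAngleDeriv {e m : ℝ} (he : 1 / 2 < e)
    (h : m ∈ regularMidpoints e) : ContinuousAt (midpointAngleDeriv e) m :=
  (hasDerivAt_intervalIntegral_of_continuousOn (isOpen_regularMidpoints he)
    (fun _ hx => hasDerivAt_kernel he hx) (fun _ hx => continuous_kernel hx)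
    (continuousOn_kernelDeriv he) h).2.const_mul 2

/-- The derivative of the apsidal angle with respect to the midpoint at a circular orbit, where
`√(radicand e m φ) = 1 - 6 * m` for all `φ`. -/
theorem midpointAngleDeriv_of_sqAmp_eq_zero {e m β : ℝ} (hβ : 0 < β) (hm : 1 - 6 * m = β ^ 2)
    (hD : sqAmp e m = 0) :
    midpointAngleDeriv e m =
      6 * Real.pi / β ^ 3 + 3 * Real.pi / 2 * (β ^ 2 - invSqMomDeriv e m) / β ^ 5 := by
  have hq : ∀ φ, √(radicand e m φ) = β ^ 2 := fun φ => by
    rw [radicand, hD, hm]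
    simp only [mul_zero, zero_mul, sub_zero]
    exact Real.sqrt_sq (by positivity)
  have hr : √(2 * (β ^ 2 + β ^ 2)) = 2 * β := by
    rw [show 2 * (β ^ 2 + β ^ 2) = (2 * β) ^ 2 by ring]
    exact Real.sqrt_sq (by positivity)
  have hk : ∀ φ, kernelDeriv e m φ =
      3 / β ^ 3 + 3 / 2 * (β ^ 2 - invSqMomDeriv e m) / β ^ 5 * Real.sin φ ^ 2 := fun φ => by
    rw [kernelDeriv, sqrtRadicandDeriv, hq, hm, hr]
    field_simp
    ring
  rw [midpointAngleDeriv]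
  simp only [hk]
  rw [intervalIntegral.integral_add (by simp) ((by fun_prop : Continuous _).intervalIntegrable _ _),
    intervalIntegral.integral_const_mul, integral_sin_sq]
  simp only [intervalIntegral.integral_const, Real.sin_neg, Real.cos_neg, Real.cos_pi_div_two,
    smul_eq_mul]
  field_simp
  ring

/-! ### Turning points -/

/-- The cubic `-2 Z` in the variable `x = M / r` at `H = -1 / 2`, with `e = E²` and `l = L / M`. -/
def cubic (e l x : ℝ) : ℝ := e - (1 + l ^ 2 * x ^ 2) * (1 - 2 * x)

theorem Z_eq_cubic {M r : ℝ} (E L : ℝ) (hM : M ≠ 0) (hr : r ≠ 0) (hr2 : r ≠ 2 * M) :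
    Z M E (-1 / 2) L r = -(1 / 2) * cubic (E ^ 2) (L / M) (M / r) := by
  have h : r - 2 * M ≠ 0 := sub_ne_zero.2 hr2
  have ha : alpha M r = (r - 2 * M) / r := by rw [alpha]; field_simp
  simp only [Z, effectivePotential, pot, cubic]
  rw [ha]
  field_simp
  ring

/-- The cubic has the roots `m - d`, `m + d` and `1 / 2 - 2 * m` when `d² = sqAmp e m` and the
angular momentum is the one belonging to the midpoint `m`. -/
theorem cubic_angMom {e m d : ℝ} (he : 1 / 2 < e) (h0 : 0 < m) (h1 : m < 1 / 8)
    (hd : d ^ 2 = sqAmp e m) (x : ℝ) :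
    cubic e (angMom e m) x =
      2 * angMom e m ^ 2 * ((x - (m - d)) * ((m + d) - x) * ((1 / 2 - 2 * m) - x)) := by
  have hW := invSqMom_pos he h0 h1
  have hl : angMom e m ^ 2 = 1 / invSqMom e m := by
    rw [angMom, div_pow, Real.sq_sqrt hW.le, one_pow]
  have hW' : invSqMom e m * (e - 4 * m) = m * (1 - 4 * m) ^ 2 :=
    div_mul_cancel₀ _ (by linarith)
  rw [cubic, hl]
  field_simp
  rw [sqAmp] at hd
  generalize invSqMom e m = W at *
  linear_combination hW' + (2 * x - 1 + 4 * m) * hd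

/-- The three roots of the cubic separate the zeros of its derivative, which are `M / r0` and
`M / rStar`. -/
theorem critical_points_interlace {M L m d : ℝ} (hM : 0 < M) (hL : 0 < L) (e : ℝ) (hd : 0 < d)
    (hdm : d < m) (hdm2 : 2 * d < 1 - 6 * m)
    (hfac : ∀ x, cubic e (L / M) x =
      2 * (L / M) ^ 2 * ((x - (m - d)) * ((m + d) - x) * ((1 / 2 - 2 * m) - x))) :
    ∃ x₀ x₁ : ℝ, m - d < x₀ ∧ x₀ < m + d ∧ m + d < x₁ ∧ x₁ < 1 / 2 - 2 * m ∧
      r0 M (-1 / 2) L = M / x₀ ∧ rStar M (-1 / 2) L = M / x₁ := by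
  set l := L / M with hl
  have hl0 : 0 < l := div_pos hL hM
  have hLl : L = M * l := by rw [hl]; field_simp
  -- Comparing coefficients yields Vieta's relation for the elementary symmetric function of degree
  -- two, which forces `l² > 12`.
  have hvieta : l ^ 2 * (m - 3 * m ^ 2 - d ^ 2) = 1 := by
    have h1 := hfac 1
    have h2 := hfac (-1)
    simp only [cubic] at h1 h2
    linear_combination (h2 - h1) / 4
  have h12 : 0 < l ^ 2 - 12 := by
    nlinarith [sq_nonneg (1 - 6 * m), mul_pos (pow_pos hl0 2) (pow_pos hd 2)]
  obtain ⟨q, hq⟩ : ∃ q, q = √(l ^ 2 - 12) := ⟨_, rfl⟩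
  have hq0 : 0 < q := hq ▸ Real.sqrt_pos.2 h12
  have hq2 : q ^ 2 = l ^ 2 - 12 := hq ▸ Real.sq_sqrt h12.le
  have hql : q < l := by nlinarith
  have hs : √(L ^ 2 + 24 * (-1 / 2) * M ^ 2) = M * q := by
    rw [hq, show L ^ 2 + 24 * (-1 / 2) * M ^ 2 = M ^ 2 * (l ^ 2 - 12) by rw [hLl]; ring,
      Real.sqrt_mul (by positivity), Real.sqrt_sq hM.le]
  have hfac' : ∀ x, (x - (l - q) / (6 * l)) * (x - (l + q) / (6 * l)) * (3 * l ^ 2) =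
      1 - l ^ 2 * x + 3 * l ^ 2 * x ^ 2 := fun x => by
    field_simp
    linear_combination -3 * hq2
  have hder : ∀ x, 1 - l ^ 2 * x + 3 * l ^ 2 * x ^ 2 =
      l ^ 2 * ((x - (m + d)) * (x - (1 / 2 - 2 * m)) + (x - (m - d)) * (x - (1 / 2 - 2 * m)) +
        (x - (m - d)) * (x - (m + d))) := fun x => by
    linear_combination -hvieta
  have hx01 : (l - q) / (6 * l) < (l + q) / (6 * l) := by gcongr; linarith
  have hs1 : 0 < (m - d - (l - q) / (6 * l)) * (m - d - (l + q) / (6 * l)) := by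
    have h := (hfac' (m - d)).trans (hder (m - d))
    refine pos_of_mul_pos_left (b := 3 * l ^ 2) ?_ (by positivity)
    rw [h]
    have := mul_pos hd (by linarith : 0 < 1 / 2 - 3 * m + d)
    exact mul_pos (by positivity) (by nlinarith)
  have hs2 : (m + d - (l - q) / (6 * l)) * (m + d - (l + q) / (6 * l)) < 0 := by
    have h := (hfac' (m + d)).trans (hder (m + d))
    refine neg_of_mul_neg_left (b := 3 * l ^ 2) ?_ (by positivity)
    rw [h]
    have := mul_pos hd (by linarith : 0 < 1 / 2 - 3 * m - d)
    exact mul_neg_of_pos_of_neg (by positivity) (by nlinarith)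
  have hs3 : 0 < (1 / 2 - 2 * m - (l - q) / (6 * l)) * (1 / 2 - 2 * m - (l + q) / (6 * l)) := by
    have h := (hfac' (1 / 2 - 2 * m)).trans (hder (1 / 2 - 2 * m))
    refine pos_of_mul_pos_left (b := 3 * l ^ 2) ?_ (by positivity)
    rw [h]
    have := mul_pos (by linarith : 0 < 1 / 2 - 3 * m + d) (by linarith : 0 < 1 / 2 - 3 * m - d)
    exact mul_pos (by positivity) (by nlinarith)
  have e0 : r0 M (-1 / 2) L = M / ((l - q) / (6 * l)) := by
    rw [r0, hs, hLl, div_div_eq_mul_div, div_eq_div_iff (by simp [hM.ne']) (by linarith)]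
    linear_combination (-M ^ 2 * l) * hq2
  have e1 : rStar M (-1 / 2) L = M / ((l + q) / (6 * l)) := by
    rw [rStar, hs, hLl, div_div_eq_mul_div, div_eq_div_iff (by simp [hM.ne']) (by linarith)]
    linear_combination (-M ^ 2 * l) * hq2
  generalize (l - q) / (6 * l) = x₀ at *
  generalize (l + q) / (6 * l) = x₁ at *
  have h2 : x₀ < m + d ∧ m + d < x₁ := by
    rcases mul_neg_iff.1 hs2 with h | h <;> constructor <;> linarith
  refine ⟨x₀, x₁, ?_, h2.1, h2.2, ?_, e0, e1⟩
  · rcases mul_pos_iff.1 hs1 with h | h <;> linarith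
  · rcases mul_pos_iff.1 hs3 with h | h <;> linarith

/-- The turning points of an orbit are read off from the two smaller roots of the cubic. -/
theorem rMinus_rPlus_eq {M E L m d : ℝ} (hM : 0 < M) (hL : 0 < L) (hd : 0 < d)
    (hdm : d < m) (hdm2 : 2 * d < 1 - 6 * m)
    (hfac : ∀ x, cubic (E ^ 2) (L / M) x =
      2 * (L / M) ^ 2 * ((x - (m - d)) * ((m + d) - x) * ((1 / 2 - 2 * m) - x))) :
    rMinus M E (-1 / 2) L = M / (m + d) ∧ rPlus M E (-1 / 2) L = M / (m - d) := by
  obtain ⟨x₀, x₁, h1, h2, h3, h4, e0, e1⟩ :=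
    critical_points_interlace hM hL (E ^ 2) hd hdm hdm2 hfac
  have hx0 : 0 < x₀ := by linarith
  have hx1 : 0 < x₁ := by linarith
  have hl : 0 < 2 * (L / M) ^ 2 := by positivity
  -- To the right of `rStar` the point lies beyond `2M`, where `Z` vanishes exactly at the roots.
  have hroot : ∀ r, M / x₁ < r → (Z M E (-1 / 2) L r = 0 ↔ M / r = m - d ∨ M / r = m + d) := by
    intro r hr
    have hr0 : 0 < r := (div_pos hM hx1).trans hr
    have hlt : M / r < x₁ := (div_lt_comm₀ hr0 hx1).2 hr
    have hr2 : r ≠ 2 * M := by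
      rintro rfl
      have : M / (2 * M) = 1 / 2 := by field_simp
      linarith
    rw [Z_eq_cubic E L hM.ne' hr0.ne' hr2, hfac]
    have h5 : 1 / 2 - 2 * m - M / r ≠ 0 := by linarith
    constructor
    · intro h
      have hne : -(1 / 2) * (2 * (L / M) ^ 2) * (1 / 2 - 2 * m - M / r) ≠ 0 :=
        mul_ne_zero (mul_ne_zero (by norm_num) hl.ne') h5
      have h6 : (M / r - (m - d)) * (m + d - M / r) = 0 :=
        (mul_eq_zero.1 (by linear_combination h)).resolve_left hne
      rcases mul_eq_zero.1 h6 with h | h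
      · exact .inl (by linarith)
      · exact .inr (by linarith)
    · rintro (h | h) <;> rw [h] <;> ring
  have hconv : ∀ {r x : ℝ}, 0 < x → (M / r = x ↔ r = M / x) := fun {r x} hx => by
    constructor
    · rintro rfl
      have : r ≠ 0 := by rintro rfl; simp at hx
      field_simp
    · rintro rfl
      field_simp
  have hx01 : M / x₁ < M / x₀ := by gcongr; linarith
  constructor
  · rw [rMinus, e0, e1]
    have : {r : ℝ | M / x₁ < r ∧ r < M / x₀ ∧ Z M E (-1 / 2) L r = 0} = {M / (m + d)} := by
      ext r
      simp only [mem_ofPred_eq, mem_singleton_iff]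
      constructor
      · rintro ⟨ha, hb, hz⟩
        rcases (hroot r ha).1 hz with h | h
        · have hr0 : 0 < r := (div_pos hM hx1).trans ha
          have := (lt_div_comm₀ hr0 hx0).1 hb
          linarith
        · exact (hconv (by linarith)).1 h
      · intro h
        have ha : M / x₁ < r := by rw [h]; gcongr; linarith
        refine ⟨ha, by rw [h]; gcongr, (hroot r ha).2 (.inr ?_)⟩
        exact (hconv (by linarith)).2 h
    rw [this, csSup_singleton]
  · rw [rPlus, e0]
    have : {r : ℝ | M / x₀ < r ∧ Z M E (-1 / 2) L r = 0} = {M / (m - d)} := by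
      ext r
      simp only [mem_ofPred_eq, mem_singleton_iff]
      constructor
      · rintro ⟨ha, hz⟩
        have hr0 : 0 < r := (div_pos hM hx0).trans ha
        have := (div_lt_comm₀ hr0 hx0).2 ha
        rcases (hroot r (hx01.trans ha)).1 hz with h | h
        · exact (hconv (by linarith)).1 h
        · linarith
      · intro h
        have ha : M / x₀ < r := by rw [h]; gcongr
        exact ⟨ha, (hroot r (hx01.trans ha)).2 (.inl ((hconv (by linarith)).2 h))⟩
    rw [this, csInf_singleton]

/-! ### The apsidal angle of an orbit -/

/-- The integrand after the substitution `s = (m + d * sin φ) / M`: the Jacobian cancels the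
singularities at the turning points. -/
theorem jacobian_mul_apsidalIntegrand {M E L m d φ : ℝ} (hM : 0 < M) (hL : 0 < L) (hd : 0 < d)
    (hdm : d < m) (hdm2 : 2 * d < 1 - 6 * m)
    (hfac : ∀ x, cubic (E ^ 2) (L / M) x =
      2 * (L / M) ^ 2 * ((x - (m - d)) * ((m + d) - x) * ((1 / 2 - 2 * m) - x)))
    (hφ : φ ∈ Ioo (-(Real.pi / 2)) (Real.pi / 2)) :
    |d * Real.cos φ / M| • apsidalIntegrand M E (-1 / 2) L ((m + d * Real.sin φ) / M) =
      (√2 / L) * (1 / √(1 - 6 * m - 2 * d * Real.sin φ)) := by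
  have hc := Real.cos_pos_of_mem_Ioo hφ
  have hs1 := Real.sin_le_one φ
  have hs2 := Real.neg_one_le_sin φ
  have hx : 0 < m + d * Real.sin φ := by nlinarith
  have hx2 : m + d * Real.sin φ < 1 / 2 := by nlinarith
  have hp : 0 < 1 - 6 * m - 2 * d * Real.sin φ := by nlinarith
  rw [apsidalIntegrand, one_div_div, Z_eq_cubic E L hM.ne' (by positivity), hfac]
  · have h1 : M / (M / (m + d * Real.sin φ)) = m + d * Real.sin φ := by field_simp
    rw [h1, abs_of_pos (by positivity)]
    have h2 : -(-(1 / 2) * (2 * (L / M) ^ 2 * ((m + d * Real.sin φ - (m - d)) *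
        (m + d - (m + d * Real.sin φ)) * (1 / 2 - 2 * m - (m + d * Real.sin φ))))) =
        (L / M * (d * Real.cos φ)) ^ 2 * ((1 - 6 * m - 2 * d * Real.sin φ) / 2) := by
      rw [mul_pow, mul_pow, Real.cos_sq']
      ring
    rw [h2, Real.sqrt_mul (by positivity), Real.sqrt_sq (by positivity),
      Real.sqrt_div hp.le]
    have := Real.sqrt_pos.2 hp
    simp only [smul_eq_mul]
    field_simp
  · intro h
    rw [div_eq_iff hx.ne'] at h
    nlinarith

/-- Averaging over `φ` and `-φ` turns the integrand into `kernel e m φ`. -/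
theorem half_sum_eq_kernel {e m d : ℝ} (hdm2 : 2 * d < 1 - 6 * m) (hd : 0 < d)
    (hD : d ^ 2 = sqAmp e m) (φ : ℝ) :
    (1 / √(1 - 6 * m - 2 * d * Real.sin φ) + 1 / √(1 - 6 * m - 2 * d * Real.sin (-φ))) / 2 =
      kernel e m φ := by
  have hs1 := Real.sin_le_one φ
  have hs2 := Real.neg_one_le_sin φ
  have hp : 0 < 1 - 6 * m - 2 * d * Real.sin φ := by nlinarith
  have hn : 0 < 1 - 6 * m + 2 * d * Real.sin φ := by nlinarith
  have hp' := Real.sqrt_pos.2 hp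
  have hn' := Real.sqrt_pos.2 hn
  rw [Real.sin_neg, mul_neg, sub_neg_eq_add, kernel, radicand, ← hD,
    show (1 - 6 * m) ^ 2 - 4 * d ^ 2 * Real.sin φ ^ 2 =
      (1 - 6 * m - 2 * d * Real.sin φ) * (1 - 6 * m + 2 * d * Real.sin φ) by ring,
    Real.sqrt_mul hp.le]
  have hsum : √(2 * (1 - 6 * m + √(1 - 6 * m - 2 * d * Real.sin φ) *
      √(1 - 6 * m + 2 * d * Real.sin φ))) =
      √(1 - 6 * m - 2 * d * Real.sin φ) + √(1 - 6 * m + 2 * d * Real.sin φ) := by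
    rw [Real.sqrt_eq_iff_eq_sq (by nlinarith [mul_pos hp' hn']) (by positivity), add_sq,
      Real.sq_sqrt hp.le, Real.sq_sqrt hn.le]
    ring
  rw [hsum]
  field_simp
  ring

theorem image_affine_sin {M m d : ℝ} (hM : 0 < M) (hd : 0 < d) :
    (fun φ => (m + d * Real.sin φ) / M) '' Ioo (-(Real.pi / 2)) (Real.pi / 2) =
      Ioo ((m - d) / M) ((m + d) / M) := by
  ext s
  simp only [mem_image, mem_Ioo]
  constructor
  · rintro ⟨φ, hφ, rfl⟩
    have h := Real.cos_pos_of_mem_Ioo hφ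
    have h2 := Real.sin_sq_add_cos_sq φ
    have h3 : -1 < Real.sin φ ∧ Real.sin φ < 1 :=
      abs_lt.1 ((sq_lt_one_iff_abs_lt_one _).1 (by nlinarith))
    constructor <;> gcongr <;> nlinarith
  · rintro ⟨h1, h2⟩
    rw [div_lt_iff₀ hM] at h1
    rw [lt_div_iff₀ hM] at h2
    have ha : -1 < (s * M - m) / d := by rw [lt_div_iff₀ hd]; linarith
    have hb : (s * M - m) / d < 1 := by rw [div_lt_iff₀ hd]; linarith
    refine ⟨Real.arcsin ((s * M - m) / d), ⟨Real.neg_pi_div_two_lt_arcsin.2 ha,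
      Real.arcsin_lt_pi_div_two.2 hb⟩, ?_⟩
    rw [Real.sin_arcsin ha.le hb.le]
    field_simp
    ring

/-- For an orbit with turning points of midpoint `m`, the integral defining the apsidal angle
converges and its value is `midpointAngle (E ^ 2) m`. -/
theorem apsidalAngle_eq_midpointAngle {M E m : ℝ} (hM : 0 < M) (he : 1 / 2 < E ^ 2)
    (hm : m ∈ orbitMidpoints (E ^ 2)) :
    IntervalIntegrable (apsidalIntegrand M E (-1 / 2) (M * angMom (E ^ 2) m)) MeasureTheory.volume
        (1 / rPlus M E (-1 / 2) (M * angMom (E ^ 2) m))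
        (1 / rMinus M E (-1 / 2) (M * angMom (E ^ 2) m)) ∧
      apsidalAngle M E (-1 / 2) (M * angMom (E ^ 2) m) = midpointAngle (E ^ 2) m := by
  obtain ⟨⟨h0, h1, h2⟩, hD0, hDm⟩ := hm
  obtain ⟨d, hd'⟩ : ∃ d, d = √(sqAmp (E ^ 2) m) := ⟨_, rfl⟩
  have hd : 0 < d := hd' ▸ Real.sqrt_pos.2 hD0
  have hD : d ^ 2 = sqAmp (E ^ 2) m := hd' ▸ Real.sq_sqrt hD0.le
  have hdm : d < m := lt_of_pow_lt_pow_left₀ 2 h0.le (hD ▸ hDm)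
  have hdm2 : 2 * d < 1 - 6 * m :=
    lt_of_pow_lt_pow_left₀ 2 (by linarith) (by rw [← hD] at h2; linarith)
  have hl : 0 < angMom (E ^ 2) m := one_div_pos.2 (Real.sqrt_pos.2 (invSqMom_pos he h0 h1))
  have hfac := cubic_angMom he h0 h1 hD
  obtain ⟨L, hL'⟩ : ∃ L, L = M * angMom (E ^ 2) m := ⟨_, rfl⟩
  have hL : 0 < L := hL' ▸ mul_pos hM hl
  rw [show angMom (E ^ 2) m = L / M by rw [hL']; field_simp] at hfac
  rw [← hL']
  obtain ⟨hr1, hr2⟩ := rMinus_rPlus_eq hM hL hd hdm hdm2 hfac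
  have hle : (m - d) / M ≤ (m + d) / M := by gcongr; linarith
  have hpi : -(Real.pi / 2) ≤ Real.pi / 2 := by linarith [Real.pi_pos]
  have hder : ∀ φ ∈ Ioo (-(Real.pi / 2)) (Real.pi / 2),
      HasDerivWithinAt (fun φ => (m + d * Real.sin φ) / M) (d * Real.cos φ / M)
        (Ioo (-(Real.pi / 2)) (Real.pi / 2)) φ := fun φ _ =>
    ((((Real.hasDerivAt_sin φ).const_mul d).const_add m).div_const M).hasDerivWithinAt
  have hinj : InjOn (fun φ => (m + d * Real.sin φ) / M) (Ioo (-(Real.pi / 2)) (Real.pi / 2)) := by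
    intro x hx y hy hxy
    have : Real.sin x = Real.sin y := by
      have h := (div_left_inj' hM.ne').1 hxy
      exact mul_left_cancel₀ hd.ne' (add_left_cancel h)
    exact Real.injOn_sin (Ioo_subset_Icc_self hx) (Ioo_subset_Icc_self hy) this
  have hjac := fun φ (hφ : φ ∈ Ioo (-(Real.pi / 2)) (Real.pi / 2)) =>
    jacobian_mul_apsidalIntegrand hM hL hd hdm hdm2 hfac hφ
  obtain ⟨h, hh⟩ : ∃ h : ℝ → ℝ, h = fun φ => 1 / √(1 - 6 * m - 2 * d * Real.sin φ) := ⟨_, rfl⟩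
  have hcont : Continuous h := by
    rw [hh]
    refine Continuous.div (by fun_prop) (by fun_prop) fun φ => (Real.sqrt_pos.2 ?_).ne'
    nlinarith [Real.sin_le_one φ]
  rw [apsidalAngle, hr1, hr2, one_div_div, one_div_div]
  constructor
  · rw [intervalIntegrable_iff_integrableOn_Ioo_of_le hle, ← image_affine_sin hM hd,
      MeasureTheory.integrableOn_image_iff_integrableOn_abs_deriv_smul measurableSet_Ioo hder hinj,
      MeasureTheory.integrableOn_congr_fun hjac measurableSet_Ioo,
      ← intervalIntegrable_iff_integrableOn_Ioo_of_le hpi]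
    rw [hh] at hcont
    exact (hcont.const_mul (√2 / L)).intervalIntegrable _ _
  · have hsym : ∫ φ in -(Real.pi / 2)..Real.pi / 2, h φ =
        ∫ φ in -(Real.pi / 2)..Real.pi / 2, kernel (E ^ 2) m φ := by
      have hneg : ∫ φ in -(Real.pi / 2)..Real.pi / 2, h (-φ) =
          ∫ φ in -(Real.pi / 2)..Real.pi / 2, h φ := by
        simp
      have hcont' : Continuous fun φ => h (-φ) := hcont.comp continuous_neg
      have hsum : ∀ φ, (h φ + h (-φ)) / 2 = kernel (E ^ 2) m φ := fun φ => by
        rw [hh]; exact half_sum_eq_kernel hdm2 hd hD φ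
      simp only [← hsum]
      rw [intervalIntegral.integral_div, intervalIntegral.integral_add
        (hcont.intervalIntegrable _ _) (hcont'.intervalIntegrable _ _), hneg]
      ring
    rw [midpointAngle, ← hsym, intervalIntegral.integral_of_le hle,
      MeasureTheory.integral_Ioc_eq_integral_Ioo, ← image_affine_sin hM hd,
      MeasureTheory.integral_image_eq_integral_abs_deriv_smul measurableSet_Ioo hder hinj,
      MeasureTheory.setIntegral_congr_fun measurableSet_Ioo hjac,
      ← MeasureTheory.integral_Ioc_eq_integral_Ioo, ← intervalIntegral.integral_of_le hpi,
      intervalIntegral.integral_const_mul, ← hh, ← mul_assoc]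
    congr 1
    have := Real.mul_self_sqrt (show (0 : ℝ) ≤ 2 by norm_num)
    field_simp
    linarith

/-! ### The derivative of the apsidal angle -/

theorem exists_local_right_inverse {f : ℝ → ℝ} {f' a : ℝ} (hf : HasStrictDerivAt f f' a)
    (hf' : f' ≠ 0) :
    ∃ g : ℝ → ℝ, g (f a) = a ∧ HasDerivAt g f'⁻¹ (f a) ∧ ∀ᶠ y in 𝓝 (f a), f (g y) = y :=
  ⟨hf.localInverse f f' a hf', (hf.hasStrictFDerivAt_equiv hf').localInverse_apply_image,
    (hf.to_localInverse hf').hasDerivAt, (hf.hasStrictFDerivAt_equiv hf').eventually_right_inverse⟩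

theorem hasDerivAt_apsidalAngle {M E m : ℝ} (hM : 0 < M) (he : 1 / 2 < E ^ 2) (he1 : E ^ 2 < 1)
    (hm : m ∈ orbitMidpoints (E ^ 2)) :
    HasDerivAt (fun L => apsidalAngle M E (-1 / 2) L)
      (midpointAngleDeriv (E ^ 2) m / angMomDeriv (E ^ 2) m / M) (M * angMom (E ^ 2) m) := by
  have h0 := hm.1.1
  have h1 := hm.1.2.1
  obtain ⟨g, hg, hg', hinv⟩ := exists_local_right_inverse (hasStrictDerivAt_angMom he h0 h1)
    (angMomDeriv_neg he he1 h0 h1).ne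
  have hlM : M * angMom (E ^ 2) m / M = angMom (E ^ 2) m := by field_simp
  have hscale : HasDerivAt (fun L : ℝ => L / M) (1 / M) (M * angMom (E ^ 2) m) :=
    (hasDerivAt_id _).div_const M
  have hcomp : HasDerivAt (fun L => g (L / M)) ((angMomDeriv (E ^ 2) m)⁻¹ * (1 / M))
      (M * angMom (E ^ 2) m) :=
    HasDerivAt.comp (h₂ := g) (M * angMom (E ^ 2) m) (by rw [hlM]; exact hg') hscale
  have hval : g (M * angMom (E ^ 2) m / M) = m := by rw [hlM, hg]
  have hF : HasDerivAt (fun L => midpointAngle (E ^ 2) (g (L / M)))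
      (midpointAngleDeriv (E ^ 2) m * ((angMomDeriv (E ^ 2) m)⁻¹ * (1 / M)))
      (M * angMom (E ^ 2) m) :=
    HasDerivAt.comp (h₂ := midpointAngle (E ^ 2)) (M * angMom (E ^ 2) m)
      (by rw [hval]; exact hasDerivAt_midpointAngle he hm.1) hcomp
  refine (hF.congr_deriv (by ring)).congr_of_eventuallyEq ?_
  have e1 : ∀ᶠ L in 𝓝 (M * angMom (E ^ 2) m), g (L / M) ∈ orbitMidpoints (E ^ 2) :=
    hcomp.continuousAt.eventually
      (p := (· ∈ orbitMidpoints (E ^ 2)))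
      (by simpa only [hval] using (isOpen_orbitMidpoints he).eventually_mem hm)
  have e2 : ∀ᶠ L in 𝓝 (M * angMom (E ^ 2) m), angMom (E ^ 2) (g (L / M)) = L / M :=
    hscale.continuousAt.eventually (p := fun l => angMom (E ^ 2) (g l) = l)
      (by simpa only [hlM] using hinv)
  filter_upwards [e1, e2] with L hL1 hL2
  have := (apsidalAngle_eq_midpointAngle hM he hL1).2
  rwa [hL2, mul_div_cancel₀ _ hM.ne'] at this

/-! ### Circular orbits -/

/-- The normalised angular momentum `L / M` of the circular orbit with `M / r = m`. -/
noncomputable def circMom (m : ℝ) : ℝ := 1 / √(m * (1 - 3 * m))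

/-- The squared energy `E²` of the circular orbit with `M / r = m`. -/
noncomputable def circEnergySq (m : ℝ) : ℝ := (1 - 2 * m) ^ 2 / (1 - 3 * m)

theorem circMom_pos {m : ℝ} (h0 : 0 < m) (h1 : m < 1 / 6) : 0 < circMom m :=
  one_div_pos.2 (Real.sqrt_pos.2 (mul_pos h0 (by linarith)))

theorem circMom_sq_mul {m : ℝ} (h0 : 0 < m) (h1 : m < 1 / 6) :
    circMom m ^ 2 * (m * (1 - 3 * m)) = 1 := by
  have h : 0 < m * (1 - 3 * m) := mul_pos h0 (by linarith)
  rw [circMom, div_pow, Real.sq_sqrt h.le, one_pow, one_div_mul_cancel h.ne']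

theorem sqrt_circMom_sq_sub {m : ℝ} (h0 : 0 < m) (h1 : m < 1 / 6) :
    √(circMom m ^ 2 - 12) = circMom m * (1 - 6 * m) := by
  rw [Real.sqrt_eq_iff_eq_sq]
  · linear_combination 12 * circMom_sq_mul h0 h1
  · have := circMom_sq_mul h0 h1
    have h : 0 < circMom m ^ 2 := pow_pos (circMom_pos h0 h1) 2
    nlinarith [sq_nonneg (1 - 6 * m)]
  · exact mul_nonneg (circMom_pos h0 h1).le (by linarith)

theorem hasDerivAt_circMom {m : ℝ} (h0 : 0 < m) (h1 : m < 1 / 6) :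
    HasDerivAt circMom (-(circMom m ^ 3 * (1 - 6 * m)) / 2) m := by
  have h : 0 < m * (1 - 3 * m) := mul_pos h0 (by linarith)
  have hs := Real.sqrt_pos.2 h
  have hw : HasDerivAt (fun y : ℝ => y * (1 - 3 * y)) (1 - 6 * m) m := by
    refine ((hasDerivAt_id' m).mul (((hasDerivAt_id' m).const_mul 3).const_sub 1)).congr_deriv ?_
    ring
  refine ((hasDerivAt_const m (1 : ℝ)).div (hw.sqrt h.ne') hs.ne').congr_deriv ?_
  rw [circMom]
  field_simp
  ring

theorem hasDerivAt_circEnergySq {m : ℝ} (h1 : m < 1 / 6) :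
    HasDerivAt circEnergySq (-((1 - 2 * m) * (1 - 6 * m)) / (1 - 3 * m) ^ 2) m := by
  have h : (1 - 3 * m) ≠ 0 := by linarith
  refine (((((hasDerivAt_id' m).const_mul 2).const_sub 1).pow 2).div
    (((hasDerivAt_id' m).const_mul 3).const_sub 1) h).congr_deriv ?_
  simp only [Pi.pow_apply]
  congr 1
  ring

/-- `zeta` expresses the energy of a circular orbit through its angular momentum. -/
theorem zeta_circMom {m : ℝ} (h0 : 0 < m) (h1 : m < 1 / 6) :
    zeta (√2 * circMom m) = circEnergySq m := by
  have hl := circMom_pos h0 h1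
  have hA := circMom_sq_mul h0 h1
  have h2 : √2 ^ 2 = (2 : ℝ) := Real.sq_sqrt (by norm_num)
  have hu : (√2 * circMom m) ^ 2 = 2 * circMom m ^ 2 := by rw [mul_pow, h2]
  have hs : √((√2 * circMom m) ^ 2 - 24) = √2 * (circMom m * (1 - 6 * m)) := by
    rw [hu, show 2 * circMom m ^ 2 - 24 = 2 * (circMom m ^ 2 - 12) by ring,
      Real.sqrt_mul (by norm_num), sqrt_circMom_sq_sub h0 h1]
  obtain ⟨A, hAd⟩ : ∃ A, A = circMom m ^ 2 := ⟨_, rfl⟩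
  have hA0 : 0 < A := hAd ▸ pow_pos hl 2
  have hu4 : (√2 * circMom m) ^ 4 = 4 * A ^ 2 := by
    rw [show (√2 * circMom m) ^ 4 = ((√2 * circMom m) ^ 2) ^ 2 by ring, hu, hAd]; ring
  have hus : √2 * circMom m * (√2 * (circMom m * (1 - 6 * m))) = 2 * A * (1 - 6 * m) := by
    rw [show √2 * circMom m * (√2 * (circMom m * (1 - 6 * m))) =
      √2 ^ 2 * circMom m ^ 2 * (1 - 6 * m) by ring, h2, hAd]
  rw [← hAd] at hA hu
  rw [zeta, hs, hu4, hu, mul_right_comm _ (2 * A - 8), mul_right_comm _ (2 * A - 6), hus,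
    circEnergySq]
  have hm3 : 0 < 1 - 3 * m := by linarith
  -- Setting `c = 1 - 3 * m`, everything is a rational function of `c` alone.
  obtain ⟨c, hc⟩ : ∃ c, c = 1 - 3 * m := ⟨_, rfl⟩
  obtain rfl : m = (1 - c) / 3 := by rw [hc]; ring
  rw [← hc] at hm3 hA ⊢
  have hden : (4 * A ^ 2 - 18 * (2 * A) + 2 * A * (1 - 6 * ((1 - c) / 3)) * (2 * A - 6)) =
      8 * A ^ 2 * c ^ 3 := by
    linear_combination 24 * A * (1 + c) * hA
  rw [hden, div_eq_div_iff (by positivity) hm3.ne']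
  linear_combination c * (8 / 3 * A * (4 * c ^ 2 + 8 * c + 9) - 32) * hA

theorem differentiableAt_zeta {u : ℝ} (hu : 4 * √2 < u) : DifferentiableAt ℝ zeta u := by
  have h2 : √2 ^ 2 = (2 : ℝ) := Real.sq_sqrt (by norm_num)
  have hs := Real.sqrt_pos.2 (show (0 : ℝ) < 2 by norm_num)
  have hu2 : 32 < u ^ 2 := by nlinarith
  have hu0 : 0 < u := by linarith
  have hr : u ^ 2 - 24 ≠ 0 := by linarith
  have hden : u ^ 4 - 18 * u ^ 2 + u * (u ^ 2 - 6) * √(u ^ 2 - 24) ≠ 0 := by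
    have h1 : 0 < u * (u ^ 2 - 6) * √(u ^ 2 - 24) :=
      mul_pos (mul_pos hu0 (by linarith)) (Real.sqrt_pos.2 (by linarith))
    nlinarith
  unfold zeta
  fun_prop (disch := assumption)

theorem four_lt_circMom {m : ℝ} (h0 : 0 < m) (h1 : m < 1 / 12) : 4 < circMom m := by
  have hA := circMom_sq_mul h0 (by linarith)
  have hl := circMom_pos h0 (by linarith)
  have h : 0 < 1 - 16 * (m * (1 - 3 * m)) := by nlinarith
  have hw : 0 < m * (1 - 3 * m) := mul_pos h0 (by linarith)
  by_contra! hc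
  have h16 : circMom m ^ 2 ≤ 16 := by nlinarith
  nlinarith

theorem deriv_zeta_circMom {m : ℝ} (h0 : 0 < m) (h1 : m < 1 / 12) :
    deriv zeta (√2 * circMom m) = √2 * (1 - 2 * m) / ((1 - 3 * m) ^ 2 * circMom m ^ 3) := by
  have h6 : m < 1 / 6 := by linarith
  have hl := circMom_pos h0 h6
  have hs := Real.sqrt_pos.2 (show (0 : ℝ) < 2 by norm_num)
  have hz : DifferentiableAt ℝ zeta (√2 * circMom m) :=
    differentiableAt_zeta (by nlinarith [four_lt_circMom h0 h1])
  have hcomp : HasDerivAt (fun y => zeta (√2 * circMom y)) _ m :=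
    HasDerivAt.comp (h₂ := zeta) m hz.hasDerivAt ((hasDerivAt_circMom h0 h6).const_mul √2)
  have hce : HasDerivAt (fun y => zeta (√2 * circMom y)) _ m :=
    (hasDerivAt_circEnergySq h6).congr_of_eventuallyEq (by
      filter_upwards [lt_mem_nhds h0, gt_mem_nhds h6] with y a b using zeta_circMom a b)
  have h := hcomp.unique hce
  have hm3 : 0 < 1 - 3 * m := by linarith
  have hm6 : 0 < 1 - 6 * m := by linarith
  have h2 : √2 ^ 2 = (2 : ℝ) := Real.sq_sqrt (by norm_num)
  rw [eq_div_iff (by positivity)]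
  rw [eq_div_iff (by positivity)] at h
  have hne : √2 * (1 - 6 * m) / 2 ≠ 0 := by positivity
  apply mul_right_cancel₀ hne
  linear_combination -h - (1 - 2 * m) * (1 - 6 * m) / 2 * h2

/-- The limiting angular momentum is that of the circular orbit of energy `E`, whose inverse radius
satisfies `M / r < 1 / 12`. -/
theorem exists_circular_midpoint {E : ℝ} (M : ℝ) (h1 : 25 / 27 < E ^ 2) (h2 : E ^ 2 < 1) :
    ∃ m, 0 < m ∧ m < 1 / 12 ∧ E ^ 2 = circEnergySq m ∧ LE M E = M * circMom m := by
  have hs := Real.sqrt_pos.2 (show (0 : ℝ) < 2 by norm_num)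
  have hs2 : √2 ^ 2 = (2 : ℝ) := Real.sq_sqrt (by norm_num)
  have hex : ∃ u ∈ Ioi (4 * √2), zeta u = E ^ 2 := by
    have hc : ContinuousOn circEnergySq (Icc 0 (1 / 12)) := fun m hm =>
      (hasDerivAt_circEnergySq (by linarith [hm.2])).continuousAt.continuousWithinAt
    obtain ⟨m, hm, hme⟩ := intermediate_value_Ioo' (by norm_num) hc
      (show E ^ 2 ∈ Ioo _ _ from ⟨by
          rwa [show circEnergySq (1 / 12) = 25 / 27 by norm_num [circEnergySq]], by
          rwa [show circEnergySq 0 = 1 by norm_num [circEnergySq]]⟩)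
    exact ⟨√2 * circMom m, by have := four_lt_circMom hm.1 hm.2; simp only [mem_Ioi]; nlinarith,
      (zeta_circMom hm.1 (by linarith [hm.2])).trans hme⟩
  have hz : zeta (zetaInv (E ^ 2)) = E ^ 2 := Function.invFunOn_eq hex
  have hu : 4 * √2 < zetaInv (E ^ 2) := Function.invFunOn_mem hex
  rw [LE]
  generalize zetaInv (E ^ 2) = u at *
  have hu0 : 0 < u := by linarith
  have hu2 : 32 < u ^ 2 := by nlinarith
  -- `m` is the smaller solution of `m * (1 - 3 * m) = 2 / u ^ 2`.
  have hw0 : 1 / 4 < 1 - 24 / u ^ 2 := by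
    have : 24 / u ^ 2 < 3 / 4 := by rw [div_lt_iff₀ (by linarith)]; linarith
    linarith
  have hw1 : 1 - 24 / u ^ 2 < 1 := by
    have : 0 < 24 / u ^ 2 := by positivity
    linarith
  obtain ⟨w, hw⟩ : ∃ w, w = √(1 - 24 / u ^ 2) := ⟨_, rfl⟩
  have hwp : 0 ≤ w := hw ▸ Real.sqrt_nonneg _
  have hwsq : w ^ 2 = 1 - 24 / u ^ 2 := hw ▸ Real.sq_sqrt (by linarith)
  have hwl : 1 / 2 < w := by nlinarith
  have hwu : w < 1 := by nlinarith
  have hm0 : 0 < (1 - w) / 6 := by linarith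
  have hm1 : (1 - w) / 6 < 1 / 12 := by linarith
  have hcm : circMom ((1 - w) / 6) = u / √2 := by
    rw [circMom, show (1 - w) / 6 * (1 - 3 * ((1 - w) / 6)) = 2 / u ^ 2 by
      linear_combination (-1 / 12) * hwsq, Real.sqrt_div (by norm_num), Real.sqrt_sq hu0.le,
      one_div_div]
  refine ⟨(1 - w) / 6, hm0, hm1, ?_, by rw [hcm]; ring⟩
  rw [← zeta_circMom hm0 (by linarith), hcm, mul_div_cancel₀ _ hs.ne', hz]

/-- For the energy of the circular orbit at `m`, the squared half-distance of the turning points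
vanishes at `m` to first order. -/
theorem sqAmp_circEnergySq {m : ℝ} (h1 : m < 1 / 12) (y : ℝ) (hy : circEnergySq m - 4 * y ≠ 0) :
    sqAmp (circEnergySq m) y =
      y * (y - m) * (4 - 3 * circEnergySq m - 4 * y - 4 * m) / (circEnergySq m - 4 * y) := by
  have he : circEnergySq m * (1 - 3 * m) = (1 - 2 * m) ^ 2 := div_mul_cancel₀ _ (by linarith)
  rw [sqAmp, invSqMom, eq_div_iff hy, sub_mul, div_mul_cancel₀ _ hy]
  linear_combination y * he

theorem invSqMom_circEnergySq {m : ℝ} (h1 : m < 1 / 12) (he : 1 / 2 < circEnergySq m) :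
    invSqMom (circEnergySq m) m = m * (1 - 3 * m) := by
  have := sqAmp_circEnergySq h1 m (by linarith)
  rw [sqAmp, sub_self, mul_zero, zero_mul, zero_div] at this
  linarith

theorem invSqMomDeriv_circEnergySq {m : ℝ} (h1 : m < 1 / 12) :
    invSqMomDeriv (circEnergySq m) m = (1 - 6 * m) ^ 2 * (1 - 3 * m) / (1 - 4 * m) ^ 2 := by
  have h3 : 0 < 1 - 3 * m := by linarith
  have h4 : 0 < 1 - 4 * m := by linarith
  have h : circEnergySq m - 4 * m = (1 - 4 * m) ^ 2 / (1 - 3 * m) := by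
    rw [circEnergySq, eq_div_iff h3.ne', sub_mul, div_mul_cancel₀ _ h3.ne']; ring
  rw [invSqMomDeriv, h, div_pow, div_div_eq_mul_div, div_eq_div_iff (by positivity) (by positivity)]
  have hc : ∀ x : ℝ, (x * ((1 - 4 * m) ^ 2 / (1 - 3 * m)) + 4 * (m * (1 - 4 * m) ^ 2)) *
      (1 - 3 * m) = x * (1 - 4 * m) ^ 2 + 4 * (m * (1 - 4 * m) ^ 2) * (1 - 3 * m) := fun x => by
    rw [add_mul, mul_assoc, div_mul_cancel₀ _ h3.ne']
  rw [pow_two (1 - 3 * m), ← mul_assoc, hc]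
  ring

/-! ### Existence of bounded orbits -/

/-- Every angular momentum between `4M` and that of the circular orbit of the same energy belongs
to a bounded orbit. -/
theorem exists_orbitMidpoint {m₀ l : ℝ} (h0 : 0 < m₀) (h1 : m₀ < 1 / 12)
    (he : 25 / 27 < circEnergySq m₀) (he1 : circEnergySq m₀ < 1) (hl4 : 4 < l)
    (hl : l < circMom m₀) : ∃ m ∈ orbitMidpoints (circEnergySq m₀),
      angMom (circEnergySq m₀) m = l := by
  have hc : Continuous (cubic (circEnergySq m₀) l) := by unfold cubic; fun_prop
  have hp0 : cubic (circEnergySq m₀) l 0 < 0 := by simp only [cubic]; linarith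
  have hpm : 0 < cubic (circEnergySq m₀) l m₀ := by
    have hA := circMom_sq_mul h0 (by linarith)
    have hlt : l ^ 2 < circMom m₀ ^ 2 := by gcongr
    have hcirc : circEnergySq m₀ = (1 + circMom m₀ ^ 2 * m₀ ^ 2) * (1 - 2 * m₀) := by
      rw [circEnergySq, div_eq_iff (by linarith)]
      linear_combination (-m₀ * (1 - 2 * m₀)) * hA
    have hpos : 0 < m₀ ^ 2 * (1 - 2 * m₀) := mul_pos (by positivity) (by linarith)
    rw [cubic]
    nlinarith
  have hp4 : cubic (circEnergySq m₀) l (1 / 4) < 0 := by simp only [cubic]; nlinarith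
  have hp2 : 0 < cubic (circEnergySq m₀) l (1 / 2) := by simp only [cubic]; linarith
  obtain ⟨s₁, ⟨a1, b1⟩, z1⟩ := intermediate_value_Ioo h0.le hc.continuousOn ⟨hp0, hpm⟩
  obtain ⟨s₂, ⟨a2, b2⟩, z2⟩ := intermediate_value_Ioo' (by linarith : m₀ ≤ 1 / 4)
    hc.continuousOn ⟨hp4, hpm⟩
  obtain ⟨s₃, ⟨a3, b3⟩, z3⟩ := intermediate_value_Ioo (by norm_num : (1 / 4 : ℝ) ≤ 1 / 2)
    hc.continuousOn ⟨hp4, hp2⟩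
  generalize circEnergySq m₀ = e at *
  simp only [cubic] at z1 z2 z3
  have hl2 : l ^ 2 ≠ 0 := by positivity
  -- Vieta's relations, from divided differences of the cubic at its roots.
  have v12 : 2 - l ^ 2 * (s₁ + s₂) + 2 * l ^ 2 * (s₁ ^ 2 + s₁ * s₂ + s₂ ^ 2) = 0 := by
    apply mul_left_cancel₀ (sub_ne_zero.2 (by linarith : s₂ ≠ s₁))
    linear_combination z2 - z1
  have v13 : 2 - l ^ 2 * (s₁ + s₃) + 2 * l ^ 2 * (s₁ ^ 2 + s₁ * s₃ + s₃ ^ 2) = 0 := by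
    apply mul_left_cancel₀ (sub_ne_zero.2 (by linarith : s₃ ≠ s₁))
    linear_combination z3 - z1
  have hsum : s₃ = 1 / 2 - s₁ - s₂ := by
    have h : (s₃ - s₂) * l ^ 2 ≠ 0 := mul_ne_zero (sub_ne_zero.2 (by linarith)) hl2
    apply mul_left_cancel₀ h
    linear_combination (v13 - v12) / 2
  have hW : invSqMom e ((s₁ + s₂) / 2) = 1 / l ^ 2 := by
    rw [invSqMom, div_eq_div_iff (by linarith) hl2]
    subst hsum
    linear_combination -z1 + (s₁ - (1 / 2 - s₁ - s₂)) * v12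
  have hD : sqAmp e ((s₁ + s₂) / 2) = ((s₂ - s₁) / 2) ^ 2 := by
    rw [sqAmp, hW]
    field_simp
    linear_combination -2 * v12
  refine ⟨(s₁ + s₂) / 2, ⟨⟨by linarith, by linarith, ?_⟩, ?_, ?_⟩, ?_⟩
  · rw [hD]; nlinarith
  · rw [hD]; have : 0 < (s₂ - s₁) / 2 := by linarith
    positivity
  · rw [hD]; nlinarith [mul_pos a1 (a1.trans (b1.trans a2))]
  · rw [angMom, hW, Real.sqrt_div zero_le_one, Real.sqrt_one, Real.sqrt_sq (by linarith),
      one_div_one_div]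

/-! ### The limit at the circular orbit -/

/-- The derivative of the apsidal angle extends continuously to the circular orbit: the orbits of
slightly smaller angular momentum have midpoints close to `m₀`, and `midpointAngle` and `angMom`
are continuously differentiable there. -/
theorem tendsto_deriv_apsidalAngle {M E m₀ : ℝ} (hM : 0 < M) (h0 : 0 < m₀) (h1 : m₀ < 1 / 12)
    (hE : E ^ 2 = circEnergySq m₀) (he : 25 / 27 < E ^ 2) (he1 : E ^ 2 < 1) :
    Tendsto (fun L => deriv (fun l => apsidalAngle M E (-1 / 2) l) L)
      (𝓝[<] (M * angMom (E ^ 2) m₀))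
      (𝓝 (midpointAngleDeriv (E ^ 2) m₀ / angMomDeriv (E ^ 2) m₀ / M)) := by
  have he2 : 1 / 2 < E ^ 2 := by linarith
  have h8 : m₀ < 1 / 8 := by linarith
  have hD0 : sqAmp (E ^ 2) m₀ = 0 := by
    rw [hE, sqAmp_circEnergySq h1 _ (by rw [← hE]; linarith)]; simp
  have hreg : m₀ ∈ regularMidpoints (E ^ 2) :=
    ⟨h0, h8, by rw [hD0, mul_zero]; exact pow_pos (by linarith) 2⟩
  have hneg := angMomDeriv_neg he2 he1 h0 h8
  obtain ⟨g, hg, hg', hinv⟩ := exists_local_right_inverse (hasStrictDerivAt_angMom he2 h0 h8)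
    hneg.ne
  have hlM : M * angMom (E ^ 2) m₀ / M = angMom (E ^ 2) m₀ := by field_simp
  have hscale : Tendsto (fun L : ℝ => L / M) (𝓝[<] (M * angMom (E ^ 2) m₀))
      (𝓝 (angMom (E ^ 2) m₀)) := by
    have h : ContinuousAt (fun L : ℝ => L / M) (M * angMom (E ^ 2) m₀) := by fun_prop
    rw [ContinuousAt, hlM] at h
    exact h.mono_left nhdsWithin_le_nhds
  have hgt : Tendsto (fun L => g (L / M)) (𝓝[<] (M * angMom (E ^ 2) m₀)) (𝓝 m₀) := by
    have h := hg'.continuousAt.tendsto.comp hscale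
    rwa [hg] at h
  have hangc : ContinuousAt (angMomDeriv (E ^ 2)) m₀ := by
    have hW : ContinuousAt (invSqMom (E ^ 2)) m₀ :=
      (hasStrictDerivAt_invSqMom (by linarith)).hasDerivAt.continuousAt
    have hW' : ContinuousAt (invSqMomDeriv (E ^ 2)) m₀ := by
      unfold invSqMomDeriv
      exact ContinuousAt.div (by fun_prop) (by fun_prop) (pow_ne_zero 2 (by linarith))
    have hs := Real.sqrt_pos.2 (invSqMom_pos he2 h0 h8)
    unfold angMomDeriv
    exact ((hW'.div (hW.sqrt.const_mul 2) (by positivity)).neg).div (hW.sqrt.pow 2) (by positivity)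
  have hlim := (((continuousAt_midpointAngleDeriv he2 hreg).div hangc hneg.ne).div_const M).tendsto
    |>.comp hgt
  refine hlim.congr' ?_
  have e1 := hgt.eventually ((isOpen_regularMidpoints he2).mem_nhds hreg)
  have e2 := hscale.eventually hinv
  have e3 := hgt.eventually ((continuousAt_sqAmp he2 h8).eventually_lt
    (g := fun m => m ^ 2) (by fun_prop) (by rw [hD0]; positivity))
  filter_upwards [e1, e2, e3, self_mem_nhdsWithin] with L hr hi hlt hL
  have hLM : L / M < angMom (E ^ 2) m₀ := by rw [div_lt_iff₀' hM]; exact hL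
  -- Smaller angular momentum means a larger midpoint, where `sqAmp` is positive.
  have hgm : m₀ < g (L / M) :=
    ((strictAntiOn_angMom he2 he1).lt_iff_gt ⟨hr.1, hr.2.1⟩ ⟨h0, h8⟩).1 (by rw [hi]; exact hLM)
  have hpos : 0 < sqAmp (E ^ 2) (g (L / M)) := by
    have hden : 0 < circEnergySq m₀ - 4 * g (L / M) := by rw [← hE]; linarith [hr.2.1]
    rw [hE, sqAmp_circEnergySq h1 _ hden.ne']
    refine div_pos (mul_pos (mul_pos hr.1 (by linarith)) ?_) hden
    rw [← hE]
    linarith [hr.2.1]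
  have hd := (hasDerivAt_apsidalAngle hM he2 he1 ⟨hr, hpos, hlt⟩).deriv
  rw [hi, mul_div_cancel₀ _ hM.ne'] at hd
  exact hd.symm

/-- The closed form of the limit, in terms of the circular orbit. -/
theorem limit_eq {M m β ρ : ℝ} (hM : 0 < M) (h0 : 0 < m) (h1 : m < 1 / 12) (hβ : 0 < β)
    (hβ2 : 1 - 6 * m = β ^ 2) (hρ : 0 < ρ) (hρ2 : circMom m = ρ ^ 2)
    (he : 25 / 27 < circEnergySq m) :
    midpointAngleDeriv (circEnergySq m) m / angMomDeriv (circEnergySq m) m / M =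
      -3 * Real.pi * (4 * (ρ ^ 2 * β ^ 2) + 5 / √2 * ρ ^ 4 *
        (√2 * (1 - 2 * m) / ((1 - 3 * m) ^ 2 * ρ ^ 6))) / (M * ρ * (ρ * β) ^ 7) := by
  have h3 : 0 < 1 - 3 * m := by linarith
  have h4 : 0 < 1 - 4 * m := by linarith
  have hW := invSqMom_circEnergySq h1 (by linarith)
  have hD0 : sqAmp (circEnergySq m) m = 0 := by rw [sqAmp, hW]; ring
  have hA : ρ ^ 4 * (m * (1 - 3 * m)) = 1 := by
    have h := circMom_sq_mul h0 (by linarith)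
    rw [hρ2] at h
    linear_combination h
  have hs : √(invSqMom (circEnergySq m) m) = 1 / ρ ^ 2 := by
    rw [hW, ← hρ2, circMom, one_div_one_div]
  rw [midpointAngleDeriv_of_sqAmp_eq_zero hβ hβ2 hD0, angMomDeriv, hs,
    invSqMomDeriv_circEnergySq h1, hβ2]
  have h2 := Real.sqrt_pos.2 (show (0 : ℝ) < 2 by norm_num)
  have h3' := h3.ne'
  have h4' := h4.ne'
  have hdiff : β ^ 2 - (β ^ 2) ^ 2 * (1 - 3 * m) / (1 - 4 * m) ^ 2 =
      β ^ 2 * (m * (1 - 2 * m) / (1 - 4 * m) ^ 2) := by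
    have h : (1 - 3 * m) / (1 - 4 * m) ^ 2 * (1 - 6 * m) =
        1 - m * (1 - 2 * m) / (1 - 4 * m) ^ 2 := by
      rw [eq_sub_iff_add_eq, div_mul_eq_mul_div, ← add_div, div_eq_one_iff_eq (by positivity)]
      ring
    rw [← hβ2]
    linear_combination (-(1 - 6 * m)) * h
  have hzeta : 5 / √2 * ρ ^ 4 * (√2 * (1 - 2 * m) / ((1 - 3 * m) ^ 2 * ρ ^ 6)) =
      5 * ρ ^ 2 * (m * (1 - 2 * m) / (1 - 3 * m)) := by
    have h : 1 / (1 - 3 * m) = m * ρ ^ 4 := by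
      rw [div_eq_iff h3']; linear_combination -hA
    have hsq : 5 / √2 * ρ ^ 4 * (√2 * (1 - 2 * m) / ((1 - 3 * m) ^ 2 * ρ ^ 6)) =
        5 * (1 - 2 * m) * (1 / (1 - 3 * m)) ^ 2 / ρ ^ 2 := by
      generalize 1 - 3 * m = c at *
      field_simp
    rw [hsq, div_eq_mul_one_div (m * (1 - 2 * m)) (1 - 3 * m), h]
    field_simp
  rw [hdiff, hzeta]
  obtain ⟨c, hc⟩ : ∃ c, c = 1 - 4 * m := ⟨_, rfl⟩
  rw [← hc] at h4 ⊢
  field_simp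
  rw [hc, ← hβ2]
  ring

end Schwarzschild

theorem mainTheorem6 (M E : ℝ) (hM : 0 < M) (hE : √(25 / 27 : ℝ) < E ∧ E < 1) :
    4 * M < Schwarzschild.LE M E ∧
    (∀ L ∈ Ioo (4 * M) (Schwarzschild.LE M E),
      IntervalIntegrable (Schwarzschild.apsidalIntegrand M E (-1 / 2) L) MeasureTheory.volume
        (1 / Schwarzschild.rPlus M E (-1 / 2) L) (1 / Schwarzschild.rMinus M E (-1 / 2) L) ∧
      DifferentiableAt ℝ (fun l : ℝ => Schwarzschild.apsidalAngle M E (-1 / 2) l) L) ∧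
    ∃ ℓ : ℝ,
      ℓ = (-3 * Real.pi *
            (4 * √((Schwarzschild.LE M E) ^ 2 / M ^ 2 - 12) +
              5 / √2 * ((Schwarzschild.LE M E) ^ 2 / M ^ 2) *
                deriv Schwarzschild.zeta (√2 * (Schwarzschild.LE M E / M)))) /
          (M * √(Schwarzschild.LE M E / M) *
            ((Schwarzschild.LE M E) ^ 2 / M ^ 2 - 12) ^ (7 / 4 : ℝ)) ∧
      Tendsto (fun L : ℝ => deriv (fun l : ℝ => Schwarzschild.apsidalAngle M E (-1 / 2) l) L)
        (𝓝[<] (Schwarzschild.LE M E)) (𝓝 ℓ) ∧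
      ℓ < 0 := by
  open Schwarzschild in
  have hE0 : 0 < E := (Real.sqrt_nonneg _).trans_lt hE.1
  have he : 25 / 27 < E ^ 2 := (Real.sqrt_lt' hE0).1 hE.1
  have he1 : E ^ 2 < 1 := by nlinarith [hE.2]
  have he2 : 1 / 2 < E ^ 2 := by linarith
  obtain ⟨m, h0, h1, hEm, hLE⟩ := exists_circular_midpoint M he he1
  have hl := circMom_pos h0 (by linarith)
  have hb : 0 < 1 - 6 * m := by linarith
  have hang : angMom (E ^ 2) m = circMom m := by
    rw [angMom, hEm, invSqMom_circEnergySq h1 (by linarith), circMom]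
  refine ⟨by rw [hLE]; nlinarith [four_lt_circMom h0 h1], fun L hL => ?_, _, rfl, ?_, ?_⟩
  · obtain ⟨y, hy, hyl⟩ := exists_orbitMidpoint (l := L / M) h0 h1 (by linarith) (by linarith)
      (by rw [lt_div_iff₀ hM]; exact hL.1)
      (by rw [div_lt_iff₀' hM, ← hLE]; exact hL.2)
    rw [← hEm] at hy hyl
    have hLy : L = M * angMom (E ^ 2) y := by rw [hyl]; field_simp
    rw [hLy]
    exact ⟨(apsidalAngle_eq_midpointAngle hM he2 hy).1,
      (hasDerivAt_apsidalAngle hM he2 he1 hy).differentiableAt⟩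
  all_goals
    have hρ : 0 < √(circMom m) := Real.sqrt_pos.2 hl
    have hβ : 0 < √(1 - 6 * m) := Real.sqrt_pos.2 hb
    have hρ2 : circMom m = √(circMom m) ^ 2 := (Real.sq_sqrt hl.le).symm
    have hβ2 : 1 - 6 * m = √(1 - 6 * m) ^ 2 := (Real.sq_sqrt hb.le).symm
    have hsq : LE M E ^ 2 / M ^ 2 = circMom m ^ 2 := by rw [hLE]; field_simp
    have hdiv : LE M E / M = circMom m := by rw [hLE]; field_simp
    have hroot := sqrt_circMom_sq_sub h0 (by linarith)
    have hpow : (circMom m ^ 2 - 12) ^ (7 / 4 : ℝ) = (√(circMom m) * √(1 - 6 * m)) ^ 7 := by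
      have h : circMom m ^ 2 - 12 = (√(circMom m) * √(1 - 6 * m)) ^ 4 := by
        have hA := circMom_sq_mul h0 (by linarith)
        rw [show (√(circMom m) * √(1 - 6 * m)) ^ 4 =
          (√(circMom m) ^ 2) ^ 2 * (√(1 - 6 * m) ^ 2) ^ 2 by ring, ← hρ2, ← hβ2]
        linear_combination 12 * hA
      rw [h, ← Real.rpow_natCast, ← Real.rpow_mul (by positivity), ← Real.rpow_natCast]
      norm_num
    rw [hsq, hdiv, hroot, hpow, deriv_zeta_circMom h0 h1]
  · rw [hLE, ← hang]
    convert tendsto_deriv_apsidalAngle hM h0 h1 hEm he he1 using 2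
    rw [hang, hEm, limit_eq hM h0 h1 hβ hβ2 hρ hρ2 (by linarith), hβ2.symm,
      show √(circMom m) ^ 4 = (√(circMom m) ^ 2) ^ 2 by ring,
      show √(circMom m) ^ 6 = (√(circMom m) ^ 2) ^ 3 by ring, ← hρ2]
  · have h3 : 0 < 1 - 3 * m := by linarith
    have h2 : 0 < 1 - 2 * m := by linarith
    have hpi := Real.pi_pos
    refine div_neg_of_neg_of_pos (mul_neg_of_neg_of_pos (by linarith) ?_) (by positivity)
    positivity
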